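/- For integers $n\ge 1$, $k\ge 2$ and $q\in[0,1]$ let $\mathcal H_k(n,q)$ be the random collection of $k$-subsets of $V=\{1,\dots,n\}$ to which each $k$-subset belongs with probability $q$, independently of all other $k$-subsets. For a collection $\mathcal H$ of subsets of $V$ let $K(\mathcal H)$ be the graph on $V$ whose edge set is the union of the edge sets of the complete graphs on the members of $\mathcal H$. Let $G(n,q)$ be the binomial random graph, in which each pair of vertices is an edge with probability $q$ independently, and let $G(n,q_2,q_3,q_4)=G(n,q_2)\cup K(\mathcal H_3(n,q_3))\cup K(\mathcal H_4(n,q_4))$, where the three random graphs are independent. For random graphs $X,Y$ on $V$ put $d_{TV}(X,Y)=\frac12\sum_{G}\bigl|\Pr[X=G]-\Pr[Y=G]\bigr|$, the sum being over all graphs $G$ on $V$. **Proposition.** Let $m=m(n)$ be positive integers with $m\gg n^4$, i.e. $m/n^4\to\infty$ as $n\to\infty$, let $0\le p=p(n)\le 1$ with $p\le\left(\frac{3\log n}{m}\right)^{1/2}$, and for $k\in\{2,3,4\}$ let $p_k=1-e^{-mp^k(1-p)^{n-k}}$. Then, as $n\to\infty$, $$d_{TV}\bigl(G(n,p_2,p_3,p_4),\,G(n,p_2)\bigr)=O(\varepsilon),\qquad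 \varepsilon:=\max\Bigl\{\frac1{\log n},\frac1{\log(m/n^4)}\Bigr\}.$$ Here the implied constant is absolute, and the bound holds for all $n\ge n_0$, where $n_0$ depends only on the function $m(n)$, uniformly over all such $p$. -/

import Mathlib

open MeasureTheory ProbabilityTheory Filter unitInterval

noncomputable section

namespace RandomCliqueUnion

/-- The random collection `𝓗_k(n, q)` of `k`-subsets of the vertex set `Fin n`: each `k`-subset
belongs to it with probability `q`, independently of all the others, and nothing else belongs
to it. -/
def randomSubsets (n k : ℕ) (q : I) : Measure (Set (Finset (Fin n))) :=
  setBernoulli {S : Finset (Fin n) | S.card = k} q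

/-- The graph `K(𝓗)`: its edge set is the union of the edge sets of the complete graphs on the
members of the collection `𝓗`. -/
def cliqueUnion {V : Type*} (H : Set (Finset V)) : SimpleGraph V where
  Adj u v := u ≠ v ∧ ∃ S ∈ H, u ∈ S ∧ v ∈ S
  symm := ⟨fun _ _ h => ⟨h.1.symm, h.2.imp fun _ hS => ⟨hS.1, hS.2.2, hS.2.1⟩⟩⟩
  loopless := ⟨fun _ h => h.1 rfl⟩

/-- The law of the random graph `G(n, q₂, q₃, q₄)`, the union of the binomial random graph
`G(n, q₂)`, of `K(𝓗₃(n, q₃))` and of `K(𝓗₄(n, q₄))`, where the three random objects are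
independent. -/
def randomCliqueGraph (n : ℕ) (q₂ q₃ q₄ : I) : Measure (SimpleGraph (Fin n)) :=
  ((SimpleGraph.binomialRandom (Fin n) q₂).prod
      ((randomSubsets n 3 q₃).prod (randomSubsets n 4 q₄))).map
    fun x => x.1 ⊔ cliqueUnion x.2.1 ⊔ cliqueUnion x.2.2

instance (n k : ℕ) (q : I) : IsProbabilityMeasure (randomSubsets n k q) := by
  unfold randomSubsets; infer_instance

instance {V : Type*} [Countable V] : MeasurableSingletonClass (SimpleGraph V) :=
  ⟨fun G => by
    have h : MeasurableSet (SimpleGraph.edgeSet ⁻¹' {G.edgeSet} : Set (SimpleGraph V)) :=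
      SimpleGraph.measurable_edgeSet (measurableSet_singleton _)
    have h' : (SimpleGraph.edgeSet ⁻¹' {G.edgeSet} : Set (SimpleGraph V)) = {G} := by
      ext G'; simp
    rwa [h'] at h⟩

theorem measurable_union (n : ℕ) :
    Measurable fun x : SimpleGraph (Fin n) × Set (Finset (Fin n)) × Set (Finset (Fin n)) =>
      x.1 ⊔ cliqueUnion x.2.1 ⊔ cliqueUnion x.2.2 :=
  measurable_of_countable _

instance (n : ℕ) (q₂ q₃ q₄ : I) : IsProbabilityMeasure (randomCliqueGraph n q₂ q₃ q₄) :=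
  Measure.isProbabilityMeasure_map (measurable_union n).aemeasurable

/-- The total variation distance `(1/2) ∑_G |Pr[X = G] - Pr[Y = G]|` between two laws on a finite
type. -/
def tvDist {α : Type*} [Fintype α] [MeasurableSpace α] (μ ν : Measure α) : ℝ :=
  (1 / 2) * ∑ a : α, |μ.real {a} - ν.real {a}|

/-- The probability `p_k = 1 - exp(-m p^k (1-p)^(n-k))` (used for `k ≤ n`). -/
def cliqueProb (n m : ℕ) (p : I) (k : ℕ) : I :=
  ⟨1 - Real.exp (-((m : ℝ) * (p : ℝ) ^ k * (1 - (p : ℝ)) ^ (n - k))), by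
    have h : 0 ≤ (m : ℝ) * (p : ℝ) ^ k * (1 - (p : ℝ)) ^ (n - k) :=
      mul_nonneg (mul_nonneg m.cast_nonneg (pow_nonneg p.2.1 _))
        (pow_nonneg (sub_nonneg.2 p.2.2) _)
    have h1 := Real.exp_pos (-((m : ℝ) * (p : ℝ) ^ k * (1 - (p : ℝ)) ^ (n - k)))
    have h2 := Real.exp_le_one_iff.2 (neg_nonpos.2 h)
    exact ⟨by linarith, by linarith⟩⟩

/-- The error term `ε = max {1 / log n, 1 / log (m / n⁴)}`. -/
def errorTerm (n m : ℕ) : ℝ :=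
  max (1 / Real.log n) (1 / Real.log ((m : ℝ) / (n : ℝ) ^ 4))

end RandomCliqueUnion

end

/-! Let `t k = m * p ^ k * (1 - p) ^ (n - k)`, so that `p_k = 1 - exp (-t k)`. Reveal the planted
cliques in continuous time: by Russo's formula, the mean of a test function `|f| ≤ 1` then moves at
a speed equal to the total effect of planting one more clique. So the total variation distance is at
most half of `D₃ * t 3 + D₄ * t 4`, where `D_k` bounds that effect in `G(n, p₂)` for every such `f`.

Planting a clique amounts to conditioning on its presence. The total effect is therefore the mean of
`f` times a sum of centred likelihood ratios, and Cauchy–Schwarz bounds it by the standard deviation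
of that sum (`sq_sum_bernoulliMean_union_sub_le`). Only pairs of cliques sharing an edge contribute
to the variance.

Put `θ = t 2`. Since `(1 - p) ^ n ≥ 1 / 2`, the rates satisfy `t 3 ^ 2 * m ≤ 2 * θ ^ 3` and `t 4 * m
≤ 2 * θ ^ 2`, which offset the negative powers of `p₂` in the variance. This gives `D₃ * t 3 = O(s)`
and `D₄ * t 4 = O(s ^ 2)` with `s = sqrt (n ^ 4 / m)`, which is stronger than the required
logarithmic bound. -/

noncomputable section

namespace RandomCliqueUnion

open scoped Finset

/-! ### Means over random subsets: Russo's formula and the second moment bound. -/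

section BernoulliMean

variable {ι : Type*} [DecidableEq ι]

/-- The mean of `g A`, where `A` is a random subset of `u` that contains each element with
probability `q`, independently. -/
def bernoulliMean (u : Finset ι) (q : ℝ) (g : Finset ι → ℝ) : ℝ :=
  ∑ A ∈ u.powerset, q ^ #A * (1 - q) ^ #(u \ A) * g A

theorem bernoulliMean_congr {u : Finset ι} {q : ℝ} {f g : Finset ι → ℝ}
    (h : ∀ A ⊆ u, f A = g A) : bernoulliMean u q f = bernoulliMean u q g :=
  Finset.sum_congr rfl fun A hA => by rw [h A (Finset.mem_powerset.1 hA)]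

@[simp]
theorem bernoulliMean_empty (q : ℝ) (g : Finset ι → ℝ) : bernoulliMean ∅ q g = g ∅ := by
  simp [bernoulliMean]

theorem bernoulliMean_insert {u : Finset ι} {a : ι} (ha : a ∉ u) (q : ℝ) (g : Finset ι → ℝ) :
    bernoulliMean (insert a u) q g =
      (1 - q) * bernoulliMean u q g + q * bernoulliMean u q (fun A => g (insert a A)) := by
  unfold bernoulliMean
  rw [Finset.sum_powerset_insert ha, Finset.mul_sum, Finset.mul_sum]
  congr 1
  · refine Finset.sum_congr rfl fun A hA => ?_
    have haA : a ∉ A := fun h => ha (Finset.mem_powerset.1 hA h)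
    rw [Finset.insert_sdiff_of_notMem _ haA, Finset.card_insert_of_notMem (by simp [ha])]
    ring
  · refine Finset.sum_congr rfl fun A hA => ?_
    have haA : a ∉ A := fun h => ha (Finset.mem_powerset.1 hA h)
    rw [Finset.insert_sdiff_insert, Finset.card_insert_of_notMem haA,
      Finset.sdiff_insert_of_notMem ha]
    ring

theorem bernoulliMean_add (u : Finset ι) (q : ℝ) (f g : Finset ι → ℝ) :
    bernoulliMean u q (fun A => f A + g A) = bernoulliMean u q f + bernoulliMean u q g := by
  simp [bernoulliMean, mul_add, Finset.sum_add_distrib]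

theorem bernoulliMean_sub (u : Finset ι) (q : ℝ) (f g : Finset ι → ℝ) :
    bernoulliMean u q (fun A => f A - g A) = bernoulliMean u q f - bernoulliMean u q g := by
  simp [bernoulliMean, mul_sub, Finset.sum_sub_distrib]

theorem bernoulliMean_const_mul (u : Finset ι) (q c : ℝ) (g : Finset ι → ℝ) :
    bernoulliMean u q (fun A => c * g A) = c * bernoulliMean u q g := by
  simp [bernoulliMean, Finset.mul_sum, mul_left_comm]

theorem bernoulliMean_sum {κ : Type*} (s : Finset κ) (u : Finset ι) (q : ℝ)
    (g : κ → Finset ι → ℝ) :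
    bernoulliMean u q (fun A => ∑ i ∈ s, g i A) = ∑ i ∈ s, bernoulliMean u q (g i) := by
  simp only [bernoulliMean, Finset.mul_sum]
  exact Finset.sum_comm

@[simp]
theorem bernoulliMean_const (u : Finset ι) (q c : ℝ) : bernoulliMean u q (fun _ => c) = c := by
  induction u using Finset.induction with
  | empty => simp
  | insert a u ha ih => rw [bernoulliMean_insert ha, ih]; ring

theorem bernoulliMean_mono {u : Finset ι} {q : ℝ} (h0 : 0 ≤ q) (h1 : q ≤ 1)
    {f g : Finset ι → ℝ} (h : ∀ A, f A ≤ g A) : bernoulliMean u q f ≤ bernoulliMean u q g :=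
  Finset.sum_le_sum fun A _ => mul_le_mul_of_nonneg_left (h A)
    (mul_nonneg (pow_nonneg h0 _) (pow_nonneg (sub_nonneg.2 h1) _))

theorem abs_bernoulliMean_le {u : Finset ι} {q : ℝ} (h0 : 0 ≤ q) (h1 : q ≤ 1)
    {f : Finset ι → ℝ} {c : ℝ} (h : ∀ A, |f A| ≤ c) : |bernoulliMean u q f| ≤ c := by
  rw [abs_le]
  constructor
  · rw [← bernoulliMean_const u q (-c)]
    exact bernoulliMean_mono h0 h1 fun A => (abs_le.1 (h A)).1
  · conv_rhs => rw [← bernoulliMean_const u q c]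
    exact bernoulliMean_mono h0 h1 fun A => (abs_le.1 (h A)).2

theorem sq_bernoulliMean_le {u : Finset ι} {q : ℝ} (h0 : 0 ≤ q) (h1 : q ≤ 1)
    (f : Finset ι → ℝ) : bernoulliMean u q f ^ 2 ≤ bernoulliMean u q (fun A => f A ^ 2) := by
  set c := bernoulliMean u q f with hc
  have h : bernoulliMean u q (fun _ => 0) ≤ bernoulliMean u q (fun A => (f A - c) ^ 2) :=
    bernoulliMean_mono h0 h1 fun A => sq_nonneg _
  have h' : bernoulliMean u q (fun A => (f A - c) ^ 2) =
      bernoulliMean u q (fun A => f A ^ 2) - 2 * c * bernoulliMean u q f + c ^ 2 := by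
    rw [← bernoulliMean_const_mul, ← bernoulliMean_sub, ← bernoulliMean_const u q (c ^ 2),
      ← bernoulliMean_add]
    exact bernoulliMean_congr fun A _ => by ring
  rw [bernoulliMean_const, h', ← hc] at h
  linarith

/-- **Russo's formula** in the time parametrization `q = 1 - exp (-t)`. -/
theorem hasDerivAt_bernoulliMean (u : Finset ι) (g : Finset ι → ℝ) (t : ℝ) :
    HasDerivAt (fun t => bernoulliMean u (1 - Real.exp (-t)) g)
      (bernoulliMean u (1 - Real.exp (-t)) (fun A => ∑ a ∈ u, (g (insert a A) - g A))) t := by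
  induction u using Finset.induction generalizing g with
  | empty => simpa using hasDerivAt_const t (g ∅)
  | insert a u ha ih =>
    have hE : HasDerivAt (fun t : ℝ => Real.exp (-t)) (-Real.exp (-t)) t := by
      simpa using (hasDerivAt_neg t).exp
    have hq : HasDerivAt (fun t : ℝ => 1 - Real.exp (-t)) (Real.exp (-t)) t := by
      simpa using hE.const_sub 1
    have h1q : HasDerivAt (fun t : ℝ => 1 - (1 - Real.exp (-t))) (-Real.exp (-t)) t := by
      simpa using hE
    have key := (h1q.mul (ih g)).add (hq.mul (ih fun A => g (insert a A)))
    have hfun : (fun t => bernoulliMean (insert a u) (1 - Real.exp (-t)) g) =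
        ((fun t : ℝ => 1 - (1 - Real.exp (-t))) * fun t => bernoulliMean u (1 - Real.exp (-t)) g) +
        ((fun t : ℝ => 1 - Real.exp (-t)) *
          fun t => bernoulliMean u (1 - Real.exp (-t)) fun A => g (insert a A)) := by
      funext s
      simp [bernoulliMean_insert ha]
    rw [hfun]
    refine key.congr_deriv ?_
    set q := 1 - Real.exp (-t) with hqdef
    have hexp : Real.exp (-t) = 1 - q := by rw [hqdef]; ring
    rw [hexp]
    have hcomm : ∀ (A : Finset ι), ∑ b ∈ insert a u, (g (insert b A) - g A) =
        (g (insert a A) - g A) + ∑ b ∈ u, (g (insert b A) - g A) := fun A =>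
      Finset.sum_insert ha
    -- The term `b = a` vanishes because `a` is already present.
    have hcomm' : ∀ (A : Finset ι),
        ∑ b ∈ insert a u, (g (insert b (insert a A)) - g (insert a A)) =
        ∑ b ∈ u, (g (insert a (insert b A)) - g (insert a A)) := fun A => by
      rw [Finset.sum_insert ha, Finset.insert_idem, sub_self, zero_add]
      exact Finset.sum_congr rfl fun b _ => by rw [Finset.insert_comm]
    rw [bernoulliMean_insert ha]
    simp_rw [hcomm', hcomm]
    rw [bernoulliMean_add, bernoulliMean_sub]
    ring

/-- If the total effect of adding one element is at most `D`, the mean moves at speed at most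
`D`. -/
theorem abs_bernoulliMean_sub_le (u : Finset ι) (g : Finset ι → ℝ) {D t : ℝ} (ht : 0 ≤ t)
    (hD : ∀ A, |∑ a ∈ u, (g (insert a A) - g A)| ≤ D) :
    |bernoulliMean u (1 - Real.exp (-t)) g - g ∅| ≤ D * t := by
  have h0 : bernoulliMean u 0 g = g ∅ := by
    have : ∀ v : Finset ι, bernoulliMean v 0 g = g ∅ := fun v => by
      induction v using Finset.induction with
      | empty => simp
      | insert a v ha ih => rw [bernoulliMean_insert ha, ih]; ring
    exact this u
  have := norm_image_sub_le_of_norm_deriv_le_segment' (a := 0) (b := t) (C := D)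
    (f := fun t => bernoulliMean u (1 - Real.exp (-t)) g)
    (fun x _ => (hasDerivAt_bernoulliMean u g x).hasDerivWithinAt)
    (fun x hx => by
      have h1 := Real.exp_pos (-x)
      have h2 := Real.exp_le_one_iff.2 (neg_nonpos.2 hx.1)
      exact abs_bernoulliMean_le (by linarith) (by linarith) hD) t ⟨ht, le_rfl⟩
  simpa [h0] using this

theorem bernoulliMean_insert_mul {u : Finset ι} {b : ι} (hb : b ∈ u) (q : ℝ)
    (f : Finset ι → ℝ) :
    bernoulliMean u q (fun A => f (insert b A)) * q =
      bernoulliMean u q (fun A => if b ∈ A then f A else 0) := by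
  have hu : insert b (u.erase b) = u := Finset.insert_erase hb
  have hne : b ∉ u.erase b := Finset.notMem_erase b u
  rw [← hu, bernoulliMean_insert hne, bernoulliMean_insert hne]
  have h0 : bernoulliMean (u.erase b) q (fun A => if b ∈ A then f A else 0) = 0 := by
    refine (bernoulliMean_congr fun A hA => ?_).trans (bernoulliMean_const (u.erase b) q 0)
    exact if_neg fun h => hne (hA h)
  rw [h0]
  simp only [Finset.insert_idem, Finset.mem_insert_self, if_true]
  ring

/-- By independence, forcing `B` into the random set gives the same law as conditioning on `B ⊆ A`,
an event of probability `q ^ #B`. -/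
theorem bernoulliMean_union_mul {u B : Finset ι} (hB : B ⊆ u) (q : ℝ) (f : Finset ι → ℝ) :
    bernoulliMean u q (fun A => f (A ∪ B)) * q ^ #B =
      bernoulliMean u q (fun A => if B ⊆ A then f A else 0) := by
  induction B using Finset.induction generalizing f with
  | empty => simp
  | insert b B hb ih =>
    rw [Finset.insert_subset_iff] at hB
    have h1 := bernoulliMean_insert_mul hB.1 q (fun A => f (A ∪ B))
    have h2 := ih hB.2 (fun A => if b ∈ A then f A else 0)
    have h3 : bernoulliMean u q (fun A => if b ∈ A then f (A ∪ B) else 0) =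
        bernoulliMean u q (fun A => if b ∈ A ∪ B then f (A ∪ B) else 0) :=
      bernoulliMean_congr fun A _ => by simp [hb]
    rw [Finset.card_insert_of_notMem hb, pow_succ, mul_comm (q ^ #B) q, ← mul_assoc]
    simp_rw [Finset.union_insert, ← Finset.insert_union]
    rw [h1, h3, h2]
    refine bernoulliMean_congr fun A _ => ?_
    by_cases h : B ⊆ A <;> simp [h, Finset.insert_subset_iff]

theorem bernoulliMean_subset {u B : Finset ι} (hB : B ⊆ u) (q : ℝ) :
    bernoulliMean u q (fun A => if B ⊆ A then 1 else 0) = q ^ #B := by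
  have := bernoulliMean_union_mul hB q (fun _ => 1)
  rw [bernoulliMean_const, one_mul] at this
  exact this.symm

/-- The second moment bound for the total effect of planting one of the sets `B i` in a random
subset. -/
theorem sq_sum_bernoulliMean_union_sub_le {κ : Type*} (s : Finset κ) {u : Finset ι}
    {B : κ → Finset ι} (hB : ∀ i ∈ s, B i ⊆ u) {q : ℝ} (h0 : 0 < q) (h1 : q ≤ 1)
    {f : Finset ι → ℝ} (hf : ∀ A, |f A| ≤ 1) :
    (∑ i ∈ s, (bernoulliMean u q (fun A => f (A ∪ B i)) - bernoulliMean u q f)) ^ 2 ≤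
      ∑ i ∈ s, ∑ j ∈ s, ((q ^ #(B i ∩ B j))⁻¹ - 1) := by
  -- `Z i` is the density of the law with `B i` planted, minus one; it has mean zero.
  let Z : κ → Finset ι → ℝ := fun i A => (q ^ #(B i))⁻¹ * (if B i ⊆ A then 1 else 0) - 1
  have e1 : ∑ i ∈ s, (bernoulliMean u q (fun A => f (A ∪ B i)) - bernoulliMean u q f) =
      bernoulliMean u q (fun A => (∑ i ∈ s, Z i A) * f A) := by
    simp_rw [Finset.sum_mul]
    rw [bernoulliMean_sum]
    refine Finset.sum_congr rfl fun i hi => ?_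
    have := bernoulliMean_union_mul (hB i hi) q f
    rw [← eq_div_iff (pow_pos h0 _).ne', div_eq_inv_mul, ← bernoulliMean_const_mul] at this
    rw [this, ← bernoulliMean_sub]
    refine bernoulliMean_congr fun A _ => ?_
    by_cases h : B i ⊆ A <;> simp [Z, h]; ring
  -- The covariance of `Z i` and `Z j` depends only on the overlap, since `#(B i ∪ B j) + #(B i ∩ B
  -- j) = #(B i) + #(B j)`.
  have e2 : bernoulliMean u q (fun A => (∑ i ∈ s, Z i A) ^ 2) =
      ∑ i ∈ s, ∑ j ∈ s, ((q ^ #(B i ∩ B j))⁻¹ - 1) := by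
    simp_rw [sq, Finset.sum_mul_sum]
    rw [bernoulliMean_sum]
    refine Finset.sum_congr rfl fun i hi => ?_
    rw [bernoulliMean_sum]
    refine Finset.sum_congr rfl fun j hj => ?_
    have e3 : bernoulliMean u q (fun A => Z i A * Z j A) =
        bernoulliMean u q (fun A =>
          (q ^ #(B i))⁻¹ * (q ^ #(B j))⁻¹ * (if B i ∪ B j ⊆ A then 1 else 0)
          - (q ^ #(B i))⁻¹ * (if B i ⊆ A then 1 else 0)
          - (q ^ #(B j))⁻¹ * (if B j ⊆ A then 1 else 0) + 1) := by
      refine bernoulliMean_congr fun A _ => ?_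
      by_cases hi : B i ⊆ A <;> by_cases hj : B j ⊆ A <;>
        simp [Z, hi, hj, Finset.union_subset_iff] <;> ring
    rw [e3, bernoulliMean_add, bernoulliMean_sub, bernoulliMean_sub, bernoulliMean_const_mul,
      bernoulliMean_const_mul, bernoulliMean_const_mul, bernoulliMean_const,
      bernoulliMean_subset (hB i hi), bernoulliMean_subset (hB j hj),
      bernoulliMean_subset (Finset.union_subset (hB i hi) (hB j hj)),
      inv_mul_cancel₀ (pow_pos h0 _).ne', inv_mul_cancel₀ (pow_pos h0 _).ne']
    have hc : q ^ #(B i ∪ B j) * q ^ #(B i ∩ B j) = q ^ #(B i) * q ^ #(B j) := by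
      rw [← pow_add, ← pow_add, Finset.card_union_add_card_inter]
    have p1 := (pow_pos h0 (#(B i))).ne'
    have p2 := (pow_pos h0 (#(B j))).ne'
    have p3 := (pow_pos h0 (#(B i ∩ B j))).ne'
    field_simp
    linear_combination hc
  rw [e1, ← e2]
  refine (sq_bernoulliMean_le h0.le h1 _).trans (bernoulliMean_mono h0.le h1 fun A => ?_)
  rw [mul_pow]
  refine mul_le_of_le_one_right (sq_nonneg _) ?_
  rw [← sq_abs]
  exact pow_le_one₀ (abs_nonneg _) (hf A)

/-- A set Bernoulli integral is a Bernoulli mean. -/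
theorem integral_setBernoulli [Finite ι] (u : Finset ι) (q : I) (f : Set ι → ℝ) :
    ∫ A, f A ∂setBernoulli (u : Set ι) q = bernoulliMean u q (fun A => f A) := by
  classical
  cases nonempty_fintype ι
  have hd : DecidablePred (fun A : Finset ι => A ∈ u.powerset) := Classical.decPred _
  rw [integral_fintype .of_finite]
  rw [← Equiv.sum_comp (Fintype.finsetEquivSet : Finset ι ≃ Set ι), bernoulliMean]
  symm
  refine Finset.sum_subset_zero_on_sdiff (Finset.subset_univ _) (fun A hA => ?_) fun A hA => ?_
  · have hA' : ¬ A ⊆ u := by simpa using hA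
    have : ¬ ((A : Set ι) ⊆ u) := by simpa using hA'
    simp [measureReal_def, setBernoulli_singleton_of_not_subset q this]
  · have hA' : (A : Set ι) ⊆ u := by simpa using hA
    have hs := setBernoulli_real_singleton q hA' u.finite_toSet
    rw [← Finset.coe_sdiff, Set.ncard_coe_finset, Set.ncard_coe_finset] at hs
    simp [hs]

end BernoulliMean

/-! ### Planting cliques in the binomial random graph. -/

section Graph

/-- The edges of the complete graph on `T`. -/
def cliqueEdges {V : Type*} [DecidableEq V] (T : Finset V) : Finset (Sym2 V) :=
  T.sym2.filter fun e => ¬ e.IsDiag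

theorem cliqueEdges_inter {V : Type*} [DecidableEq V] (S T : Finset V) :
    cliqueEdges S ∩ cliqueEdges T = cliqueEdges (S ∩ T) := by
  ext e
  simp only [cliqueEdges, Finset.mem_inter, Finset.mem_filter, Finset.mem_sym2_iff]
  grind

theorem card_cliqueEdges {V : Type*} [DecidableEq V] (T : Finset V) :
    #(cliqueEdges T) = (#T).choose 2 := by
  rw [← Sym2.card_image_offDiag]
  congr 1
  ext e
  induction e using Sym2.ind with
  | _ x y =>
    simp only [cliqueEdges, Finset.mem_filter, Finset.mk_mem_sym2_iff, Sym2.mk_isDiag_iff,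
      Finset.mem_image, Finset.mem_offDiag, Prod.exists]
    constructor
    · rintro ⟨⟨hx, hy⟩, h⟩
      exact ⟨x, y, ⟨hx, hy, h⟩, rfl⟩
    · rintro ⟨a, b, ⟨ha, hb, h⟩, hab⟩
      rcases Sym2.eq_iff.1 hab with ⟨rfl, rfl⟩ | ⟨rfl, rfl⟩
      · exact ⟨⟨ha, hb⟩, h⟩
      · exact ⟨⟨hb, ha⟩, fun h' => h h'.symm⟩

theorem cliqueUnion_insert {V : Type*} [DecidableEq V] (T : Finset V) (H : Set (Finset V)) :
    cliqueUnion (insert T H) =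
      SimpleGraph.fromEdgeSet (cliqueEdges T : Set (Sym2 V)) ⊔ cliqueUnion H := by
  ext u v
  simp only [cliqueUnion, cliqueEdges, SimpleGraph.sup_adj, SimpleGraph.fromEdgeSet_adj,
    Finset.coe_filter, Set.mem_ofPred_eq, Finset.mk_mem_sym2_iff, Sym2.mk_isDiag_iff,
    Set.mem_insert_iff]
  grind

theorem cliqueUnion_empty {V : Type*} : cliqueUnion (∅ : Set (Finset V)) = ⊥ := by
  ext u v
  simp [cliqueUnion]

theorem integral_binomialRandom (n : ℕ) (q : I) (f : SimpleGraph (Fin n) → ℝ) :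
    ∫ G, f G ∂SimpleGraph.binomialRandom (Fin n) q =
      bernoulliMean (Finset.univ.filter fun e : Sym2 (Fin n) => ¬ e.IsDiag) q
        (fun A => f (SimpleGraph.fromEdgeSet A)) := by
  rw [SimpleGraph.binomialRandom_eq_map, integral_map (measurable_of_countable _).aemeasurable
    (measurable_of_countable _).aestronglyMeasurable]
  rw [← integral_setBernoulli _ q (fun A => f (SimpleGraph.fromEdgeSet A))]
  congr 2
  ext e
  simp [Sym2.diagSet]

theorem integral_randomSubsets (n k : ℕ) (q : I) (f : Set (Finset (Fin n)) → ℝ) :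
    ∫ H, f H ∂randomSubsets n k q =
      bernoulliMean (Finset.univ.powersetCard k) q (fun A : Finset (Finset (Fin n)) => f A) := by
  rw [randomSubsets, ← integral_setBernoulli]
  congr 2
  ext S
  simp [Finset.mem_powersetCard]

/-- If `D` bounds the total effect of planting one `k`-clique in a random graph of law `μ`, then
adding the cliques on the random collection `𝓗_k(n, 1 - exp (-t))` has effect at most `D * t`. -/
theorem abs_integral_sup_cliqueUnion_sub_le {n k : ℕ} {q : I} {t D : ℝ} (ht : 0 ≤ t)
    (hq : (q : ℝ) = 1 - Real.exp (-t)) (μ : Measure (SimpleGraph (Fin n)))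
    [IsProbabilityMeasure μ]
    (hD : ∀ f : SimpleGraph (Fin n) → ℝ, (∀ G, |f G| ≤ 1) →
      |∑ T ∈ (Finset.univ : Finset (Fin n)).powersetCard k,
        (∫ G, f (G ⊔ SimpleGraph.fromEdgeSet (cliqueEdges T : Set (Sym2 (Fin n)))) ∂μ
          - ∫ G, f G ∂μ)| ≤ D)
    {f : SimpleGraph (Fin n) → ℝ} (hf : ∀ G, |f G| ≤ 1) :
    |∫ H, ∫ G, f (G ⊔ cliqueUnion H) ∂μ ∂randomSubsets n k q - ∫ G, f G ∂μ| ≤ D * t := by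
  rw [integral_randomSubsets, hq]
  have h0 : ∫ G, f G ∂μ = ∫ G, f (G ⊔ cliqueUnion ((∅ : Finset (Finset (Fin n))) : Set _)) ∂μ := by
    simp [cliqueUnion_empty]
  rw [h0]
  refine abs_bernoulliMean_sub_le (Finset.univ.powersetCard k)
    (fun A : Finset (Finset (Fin n)) => ∫ G, f (G ⊔ cliqueUnion (A : Set (Finset (Fin n)))) ∂μ) ht
    fun A => ?_
  -- The cliques already present are absorbed into the test function, which stays bounded by one;
  -- hence a bound for planting in `μ` itself suffices at all times.
  have := hD (fun G => f (G ⊔ cliqueUnion (A : Set (Finset (Fin n))))) fun G => hf _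
  simpa only [Finset.coe_insert, cliqueUnion_insert, ← sup_assoc] using this

/-- The sign of `μ.real {a} - ν.real {a}` is a test function attaining the full `ℓ¹` distance. -/
theorem tvDist_le {α : Type*} [Fintype α] [MeasurableSpace α] [MeasurableSingletonClass α]
    (μ ν : Measure α) [IsFiniteMeasure μ] [IsFiniteMeasure ν] {D : ℝ}
    (h : ∀ f : α → ℝ, (∀ a, |f a| ≤ 1) → |∫ a, f a ∂μ - ∫ a, f a ∂ν| ≤ D) :
    tvDist μ ν ≤ D / 2 := by
  have := h (fun a => SignType.sign (μ.real {a} - ν.real {a})) fun a => by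
    rcases SignType.sign (μ.real {a} - ν.real {a}) with _ | _ | _ <;> simp
  rw [integral_fintype .of_finite, integral_fintype .of_finite, ← Finset.sum_sub_distrib] at this
  have e : ∀ a, μ.real {a} • (SignType.sign (μ.real {a} - ν.real {a}) : ℝ) -
      ν.real {a} • (SignType.sign (μ.real {a} - ν.real {a}) : ℝ) = |μ.real {a} - ν.real {a}| :=
    fun a => by rw [← sub_smul, smul_eq_mul, self_mul_sign]
  simp_rw [e] at this
  have := (le_abs_self _).trans this
  unfold tvDist
  linarith

theorem integral_randomCliqueGraph (n : ℕ) (q₂ q₃ q₄ : I) (f : SimpleGraph (Fin n) → ℝ) :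
    ∫ G, f G ∂randomCliqueGraph n q₂ q₃ q₄ =
      ∫ H₄, ∫ H₃, ∫ G, f (G ⊔ cliqueUnion H₃ ⊔ cliqueUnion H₄)
        ∂SimpleGraph.binomialRandom (Fin n) q₂ ∂randomSubsets n 3 q₃ ∂randomSubsets n 4 q₄ := by
  rw [randomCliqueGraph, integral_map (measurable_union n).aemeasurable
    (measurable_of_countable _).aestronglyMeasurable, integral_prod_symm _ .of_finite,
    integral_prod_symm _ .of_finite]

/-- Total variation bound from bounds on the effect of planting one triangle and one
4-clique. -/
theorem tvDist_randomCliqueGraph_le {n : ℕ} {q₂ q₃ q₄ : I} {t₃ t₄ D₃ D₄ : ℝ}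
    (ht₃ : 0 ≤ t₃) (ht₄ : 0 ≤ t₄) (hq₃ : (q₃ : ℝ) = 1 - Real.exp (-t₃))
    (hq₄ : (q₄ : ℝ) = 1 - Real.exp (-t₄))
    (hD₃ : ∀ f : SimpleGraph (Fin n) → ℝ, (∀ G, |f G| ≤ 1) →
      |∑ T ∈ (Finset.univ : Finset (Fin n)).powersetCard 3,
        (∫ G, f (G ⊔ SimpleGraph.fromEdgeSet (cliqueEdges T : Set (Sym2 (Fin n))))
          ∂SimpleGraph.binomialRandom (Fin n) q₂
          - ∫ G, f G ∂SimpleGraph.binomialRandom (Fin n) q₂)| ≤ D₃)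
    (hD₄ : ∀ f : SimpleGraph (Fin n) → ℝ, (∀ G, |f G| ≤ 1) →
      |∑ T ∈ (Finset.univ : Finset (Fin n)).powersetCard 4,
        (∫ G, f (G ⊔ SimpleGraph.fromEdgeSet (cliqueEdges T : Set (Sym2 (Fin n))))
          ∂SimpleGraph.binomialRandom (Fin n) q₂
          - ∫ G, f G ∂SimpleGraph.binomialRandom (Fin n) q₂)| ≤ D₄) :
    tvDist (randomCliqueGraph n q₂ q₃ q₄) (SimpleGraph.binomialRandom (Fin n) q₂) ≤
      (D₃ * t₃ + D₄ * t₄) / 2 := by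
  refine tvDist_le _ _ fun f hf => ?_
  set μ := SimpleGraph.binomialRandom (Fin n) q₂
  have h4 := abs_integral_sup_cliqueUnion_sub_le ht₄ hq₄ μ hD₄ hf
  -- With the 4-cliques frozen inside the test function, adding triangles is again a perturbation of
  -- `G(n, q₂)` alone.
  have h3 : ∀ H₄ : Set (Finset (Fin n)),
      |∫ H₃, ∫ G, f (G ⊔ cliqueUnion H₃ ⊔ cliqueUnion H₄) ∂μ ∂randomSubsets n 3 q₃
        - ∫ G, f (G ⊔ cliqueUnion H₄) ∂μ| ≤ D₃ * t₃ := fun H₄ =>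
    abs_integral_sup_cliqueUnion_sub_le (f := fun G => f (G ⊔ cliqueUnion H₄)) ht₃ hq₃ μ hD₃
      fun G => hf _
  have h5 : |∫ G, f G ∂randomCliqueGraph n q₂ q₃ q₄ -
      ∫ H₄, ∫ G, f (G ⊔ cliqueUnion H₄) ∂μ ∂randomSubsets n 4 q₄| ≤ D₃ * t₃ := by
    rw [integral_randomCliqueGraph, ← integral_sub .of_finite .of_finite]
    have := norm_integral_le_of_norm_le_const (μ := randomSubsets n 4 q₄)
      (f := fun H₄ => ∫ H₃, ∫ G, f (G ⊔ cliqueUnion H₃ ⊔ cliqueUnion H₄) ∂μ ∂randomSubsets n 3 q₃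
        - ∫ G, f (G ⊔ cliqueUnion H₄) ∂μ) (C := D₃ * t₃) (Eventually.of_forall h3)
    simpa using this
  exact (abs_sub_le _ _ _).trans (add_le_add h5 h4)

/-- The total effect of planting one `k`-clique in `G(n, q)`: the trivial bound. -/
theorem abs_sum_plant_le_card (n k : ℕ) (q : I) {f : SimpleGraph (Fin n) → ℝ}
    (hf : ∀ G, |f G| ≤ 1) :
    |∑ T ∈ (Finset.univ : Finset (Fin n)).powersetCard k,
        (∫ G, f (G ⊔ SimpleGraph.fromEdgeSet (cliqueEdges T : Set (Sym2 (Fin n))))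
          ∂SimpleGraph.binomialRandom (Fin n) q
          - ∫ G, f G ∂SimpleGraph.binomialRandom (Fin n) q)| ≤ 2 * (n : ℝ) ^ k := by
  have h1 : ∀ g : SimpleGraph (Fin n) → ℝ, (∀ G, |g G| ≤ 1) →
      |∫ G, g G ∂SimpleGraph.binomialRandom (Fin n) q| ≤ 1 := fun g hg => by
    rw [integral_binomialRandom]
    exact abs_bernoulliMean_le q.2.1 q.2.2 fun A => hg _
  refine (Finset.abs_sum_le_sum_abs _ _).trans ?_
  refine (Finset.sum_le_card_nsmul _ _ 2 fun T _ => ?_).trans ?_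
  · refine (abs_sub _ _).trans ?_
    linarith [h1 f hf, h1 (fun G => f (G ⊔ SimpleGraph.fromEdgeSet
      (cliqueEdges T : Set (Sym2 (Fin n))))) fun G => hf _]
  · rw [Finset.card_powersetCard, Finset.card_univ, Fintype.card_fin, nsmul_eq_mul, mul_comm]
    gcongr
    exact_mod_cast Nat.choose_le_pow n k

/-- The total effect of planting one `k`-clique in `G(n, q)`: the second moment bound. -/
theorem sq_sum_plant_le (n k : ℕ) (q : I) (hq : 0 < (q : ℝ)) {f : SimpleGraph (Fin n) → ℝ}
    (hf : ∀ G, |f G| ≤ 1) :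
    (∑ T ∈ (Finset.univ : Finset (Fin n)).powersetCard k,
        (∫ G, f (G ⊔ SimpleGraph.fromEdgeSet (cliqueEdges T : Set (Sym2 (Fin n))))
          ∂SimpleGraph.binomialRandom (Fin n) q
          - ∫ G, f G ∂SimpleGraph.binomialRandom (Fin n) q)) ^ 2 ≤
      ∑ S ∈ (Finset.univ : Finset (Fin n)).powersetCard k,
        ∑ T ∈ (Finset.univ : Finset (Fin n)).powersetCard k,
          (((q : ℝ) ^ (#(S ∩ T)).choose 2)⁻¹ - 1) := by
  have := sq_sum_bernoulliMean_union_sub_le ((Finset.univ : Finset (Fin n)).powersetCard k)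
    (u := Finset.univ.filter fun e : Sym2 (Fin n) => ¬ e.IsDiag) (B := cliqueEdges)
    (fun T _ => Finset.filter_subset_filter _ (Finset.subset_univ _)) hq q.2.2
    (f := fun A => f (SimpleGraph.fromEdgeSet A)) (fun A => hf _)
  simp_rw [cliqueEdges_inter, card_cliqueEdges] at this
  refine le_trans (le_of_eq ?_) this
  congr 1
  refine Finset.sum_congr rfl fun T _ => ?_
  rw [integral_binomialRandom, integral_binomialRandom]
  simp only [Finset.coe_union, SimpleGraph.fromEdgeSet_union]

/-- The number of `k`-sets that meet a given `k`-set in exactly `j` elements. -/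
theorem card_filter_card_inter_le {V : Type*} [Fintype V] [DecidableEq V] {k : ℕ} {S : Finset V}
    (hS : #S = k) (j : ℕ) :
    #((Finset.univ.powersetCard k).filter fun T => #(S ∩ T) = j) ≤
      2 ^ k * Fintype.card V ^ (k - j) := by
  have h : #((Finset.univ.powersetCard k).filter fun T => #(S ∩ T) = j) ≤
      #(S.powerset ×ˢ (Finset.univ : Finset V).powersetCard (k - j)) := by
    -- `T` is recovered from `S ∩ T` and `T \ S`.
    refine Finset.card_le_card_of_injOn (fun T => (S ∩ T, T \ S)) (fun T hT => ?_)
      fun T _ T' _ h => ?_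
    · simp only [Finset.coe_filter, Finset.mem_powersetCard, Set.mem_ofPred_eq] at hT
      have := Finset.card_inter_add_card_sdiff T S
      rw [Finset.inter_comm] at this
      simp only [Finset.coe_product, Set.mem_prod, Finset.mem_coe, Finset.mem_powerset,
        Finset.mem_powersetCard]
      refine ⟨Finset.inter_subset_left, Finset.subset_univ _, ?_⟩
      omega
    · simp only [Prod.mk.injEq] at h
      rw [← Finset.sdiff_union_inter T S, ← Finset.sdiff_union_inter T' S, h.2,
        Finset.inter_comm T S, h.1, Finset.inter_comm T' S]
  refine h.trans ?_
  rw [Finset.card_product, Finset.card_powerset, hS, Finset.card_powersetCard, Finset.card_univ]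
  exact Nat.mul_le_mul_left _ (Nat.choose_le_pow _ _)

/-- A sum over pairs of `k`-sets of a function of the size of the intersection. -/
theorem sum_card_inter_le (n k : ℕ) {w : ℕ → ℝ} (hw : ∀ j, 0 ≤ w j) :
    ∑ S ∈ (Finset.univ : Finset (Fin n)).powersetCard k,
        ∑ T ∈ (Finset.univ : Finset (Fin n)).powersetCard k, w #(S ∩ T) ≤
      ∑ j ∈ Finset.range (k + 1), 2 ^ k * (n : ℝ) ^ (k + (k - j)) * w j := by
  have h1 : ∀ S ∈ (Finset.univ : Finset (Fin n)).powersetCard k,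
      ∑ T ∈ (Finset.univ : Finset (Fin n)).powersetCard k, w #(S ∩ T) ≤
        ∑ j ∈ Finset.range (k + 1), 2 ^ k * (n : ℝ) ^ (k - j) * w j := fun S hS => by
    have hS' := (Finset.mem_powersetCard.1 hS).2
    rw [← Finset.sum_fiberwise_of_maps_to (t := Finset.range (k + 1)) (g := fun T => #(S ∩ T))]
    · refine Finset.sum_le_sum fun j _ => ?_
      rw [Finset.sum_congr rfl (g := fun _ => w j) fun T hT => by
        rw [(Finset.mem_filter.1 hT).2], Finset.sum_const, nsmul_eq_mul]
      refine mul_le_mul_of_nonneg_right ?_ (hw j)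
      have := card_filter_card_inter_le hS' j
      rw [Fintype.card_fin] at this
      exact_mod_cast this
    · intro T _
      rw [Finset.mem_range, Nat.lt_succ_iff, ← hS']
      exact Finset.card_le_card Finset.inter_subset_left
  refine (Finset.sum_le_card_nsmul _ _ _ h1).trans ?_
  rw [Finset.card_powersetCard, Finset.card_univ, Fintype.card_fin, nsmul_eq_mul, Finset.mul_sum]
  refine Finset.sum_le_sum fun j _ => ?_
  have hc : (n.choose k : ℝ) ≤ (n : ℝ) ^ k := by exact_mod_cast Nat.choose_le_pow n k
  have : 0 ≤ 2 ^ k * (n : ℝ) ^ (k - j) * w j := by have := hw j; positivity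
  calc _ ≤ (n : ℝ) ^ k * (2 ^ k * (n : ℝ) ^ (k - j) * w j) :=
        mul_le_mul_of_nonneg_right hc this
    _ = _ := by rw [pow_add]; ring

end Graph

/-! ### Numerical estimates and the choice of rates. -/

section Estimates

/-- With `q = 1 - exp (-θ)`, `q⁻¹ - 1` equals `(exp θ - 1)⁻¹`, and `exp θ - 1` dominates each Taylor
term `θ ^ i / i!`. -/
theorem mul_inv_one_sub_exp_neg_sub_one_le {θ : ℝ} (hθ : 0 < θ) :
    0 ≤ (1 - Real.exp (-θ))⁻¹ - 1 ∧ θ * ((1 - Real.exp (-θ))⁻¹ - 1) ≤ 1 ∧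
      θ ^ 2 * ((1 - Real.exp (-θ))⁻¹ - 1) ≤ 2 ∧ θ ^ 3 * ((1 - Real.exp (-θ))⁻¹ - 1) ≤ 6 ∧
      θ ^ 4 * ((1 - Real.exp (-θ))⁻¹ - 1) ≤ 24 := by
  have h1 : 0 < Real.exp θ - 1 := by linarith [Real.add_one_lt_exp hθ.ne']
  have hx : (1 - Real.exp (-θ))⁻¹ - 1 = (Real.exp θ - 1)⁻¹ := by
    have h2 : Real.exp (-θ) * Real.exp θ = 1 := by rw [← Real.exp_add]; simp
    have h3 : 1 - Real.exp (-θ) ≠ 0 := fun h => by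
      have : Real.exp (-θ) = 1 := by linarith
      rw [this] at h2
      linarith
    field_simp
    linarith
  have hs := Real.sum_le_exp_of_nonneg hθ.le 5
  simp only [Finset.sum_range_succ, Finset.sum_range_zero, Nat.factorial] at hs
  norm_num at hs
  rw [hx]
  have p1 : 0 < θ ^ 2 := by positivity
  have p2 : 0 < θ ^ 3 := by positivity
  have p3 : 0 < θ ^ 4 := by positivity
  simp only [← div_eq_mul_inv, div_le_iff₀ h1]
  refine ⟨by positivity, ?_, ?_, ?_, ?_⟩ <;> linarith

theorem triangle_second_moment_le {n m : ℕ} (hn : 0 < n) (hm : 0 < m) {θ t : ℝ} (hθ : 0 < θ)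
    (ht : t ^ 2 * m ≤ 2 * θ ^ 3) :
    (∑ j ∈ Finset.range (3 + 1), 2 ^ 3 * (n : ℝ) ^ (3 + (3 - j)) *
      (((1 - Real.exp (-θ)) ^ j.choose 2)⁻¹ - 1)) * t ^ 2 ≤ 496 * ((n : ℝ) ^ 4 / m) := by
  obtain ⟨h0, h1, h2, h3, -⟩ := mul_inv_one_sub_exp_neg_sub_one_le hθ
  set x := (1 - Real.exp (-θ))⁻¹ - 1 with hx
  have hq : (1 - Real.exp (-θ))⁻¹ = 1 + x := by rw [hx]; ring
  have hn1 : (1 : ℝ) ≤ n := by exact_mod_cast hn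
  have hm0 : (0 : ℝ) < m := by exact_mod_cast hm
  -- Overlaps `j = 0, 1` share no edge and contribute nothing.
  have hsum : ∑ j ∈ Finset.range (3 + 1), 2 ^ 3 * (n : ℝ) ^ (3 + (3 - j)) *
      (((1 - Real.exp (-θ)) ^ j.choose 2)⁻¹ - 1) =
      8 * n ^ 4 * x + 8 * n ^ 3 * (3 * x + 3 * x ^ 2 + x ^ 3) := by
    simp only [Finset.sum_range_succ, Finset.sum_range_zero, ← inv_pow, hq]
    norm_num [Nat.choose]
    left
    ring
  have hle : 8 * (n : ℝ) ^ 4 * x + 8 * n ^ 3 * (3 * x + 3 * x ^ 2 + x ^ 3) ≤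
      8 * n ^ 4 * (4 * x + 3 * x ^ 2 + x ^ 3) := by
    have : (n : ℝ) ^ 3 ≤ n ^ 4 := pow_le_pow_right₀ hn1 (by norm_num)
    have h4 : 0 ≤ 3 * x + 3 * x ^ 2 + x ^ 3 := by positivity
    nlinarith [mul_le_mul_of_nonneg_right this h4]
  have hpoly : θ ^ 3 * (4 * x + 3 * x ^ 2 + x ^ 3) ≤ 31 := by
    have e : θ ^ 3 * (4 * x + 3 * x ^ 2 + x ^ 3) =
        4 * (θ ^ 3 * x) + 3 * ((θ ^ 2 * x) * (θ * x)) + (θ * x) ^ 3 := by ring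
    have a1 : (θ ^ 2 * x) * (θ * x) ≤ 2 * 1 := mul_le_mul h2 h1 (by positivity) (by norm_num)
    have a2 : (θ * x) ^ 3 ≤ 1 := pow_le_one₀ (by positivity) h1
    rw [e]
    linarith
  rw [hsum, ← mul_div_assoc, le_div_iff₀ hm0]
  calc _ ≤ 8 * (n : ℝ) ^ 4 * (4 * x + 3 * x ^ 2 + x ^ 3) * t ^ 2 * m := by gcongr
    _ = 8 * (n : ℝ) ^ 4 * ((t ^ 2 * m) * (4 * x + 3 * x ^ 2 + x ^ 3)) := by ring
    _ ≤ 8 * (n : ℝ) ^ 4 * ((2 * θ ^ 3) * (4 * x + 3 * x ^ 2 + x ^ 3)) := by gcongr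
    _ = 16 * (n : ℝ) ^ 4 * (θ ^ 3 * (4 * x + 3 * x ^ 2 + x ^ 3)) := by ring
    _ ≤ 16 * (n : ℝ) ^ 4 * 31 := by gcongr
    _ = _ := by ring

theorem four_clique_second_moment_le {n m : ℕ} (hn : 0 < n) (hm : 0 < m) {θ t : ℝ} (hθ : 1 ≤ θ)
    (ht0 : 0 ≤ t) (ht : t * m ≤ 2 * θ ^ 2) :
    (∑ j ∈ Finset.range (4 + 1), 2 ^ 4 * (n : ℝ) ^ (4 + (4 - j)) *
      (((1 - Real.exp (-θ)) ^ j.choose 2)⁻¹ - 1)) * t ^ 2 ≤ 109056 * ((n : ℝ) ^ 4 / m) ^ 2 := by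
  obtain ⟨h0, h1, -, -, h4⟩ := mul_inv_one_sub_exp_neg_sub_one_le (zero_lt_one.trans_le hθ)
  set x := (1 - Real.exp (-θ))⁻¹ - 1 with hx
  -- The assumption `1 ≤ θ` makes every higher power of `x` at most `x`.
  have hx1 : x ≤ 1 := by nlinarith
  have hq : (1 - Real.exp (-θ))⁻¹ = 1 + x := by rw [hx]; ring
  have hn1 : (1 : ℝ) ≤ n := by exact_mod_cast hn
  have hm0 : (0 : ℝ) < m := by exact_mod_cast hm
  have hsum : ∑ j ∈ Finset.range (4 + 1), 2 ^ 4 * (n : ℝ) ^ (4 + (4 - j)) *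
      (((1 - Real.exp (-θ)) ^ j.choose 2)⁻¹ - 1) =
      16 * n ^ 6 * x + 16 * n ^ 5 * ((1 + x) ^ 3 - 1) + 16 * n ^ 4 * ((1 + x) ^ 6 - 1) := by
    simp only [Finset.sum_range_succ, Finset.sum_range_zero, ← inv_pow, hq]
    norm_num [Nat.choose]
  have hxp : ∀ {i : ℕ}, i ≠ 0 → x ^ i ≤ x := pow_le_of_le_one h0 hx1
  have b3 : (1 + x) ^ 3 - 1 ≤ 7 * x := by nlinarith [hxp two_ne_zero, hxp three_ne_zero]
  have b6 : (1 + x) ^ 6 - 1 ≤ 63 * x := by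
    have e : (1 + x) ^ 6 - 1 = 6 * x + 15 * x ^ 2 + 20 * x ^ 3 + 15 * x ^ 4 + 6 * x ^ 5 + x ^ 6 := by
      ring
    rw [e]
    linarith [hxp (i := 2) (by norm_num), hxp (i := 3) (by norm_num), hxp (i := 4) (by norm_num),
      hxp (i := 5) (by norm_num), hxp (i := 6) (by norm_num)]
  have hle : 16 * (n : ℝ) ^ 6 * x + 16 * n ^ 5 * ((1 + x) ^ 3 - 1) +
      16 * n ^ 4 * ((1 + x) ^ 6 - 1) ≤ 1136 * n ^ 8 * x := by
    have c6 : (n : ℝ) ^ 6 ≤ n ^ 8 := pow_le_pow_right₀ hn1 (by norm_num)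
    have c5 : (n : ℝ) ^ 5 ≤ n ^ 8 := pow_le_pow_right₀ hn1 (by norm_num)
    have c4 : (n : ℝ) ^ 4 ≤ n ^ 8 := pow_le_pow_right₀ hn1 (by norm_num)
    calc _ ≤ 16 * (n : ℝ) ^ 8 * x + 16 * n ^ 8 * (7 * x) + 16 * n ^ 8 * (63 * x) := by
          gcongr
          · exact sub_nonneg.2 (one_le_pow₀ (by linarith))
          · exact sub_nonneg.2 (one_le_pow₀ (by linarith))
      _ = _ := by ring
  rw [hsum, div_pow, ← mul_div_assoc, le_div_iff₀ (by positivity)]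
  calc _ ≤ 1136 * (n : ℝ) ^ 8 * x * t ^ 2 * m ^ 2 := by gcongr
    _ = 1136 * (n : ℝ) ^ 8 * (x * (t * m) ^ 2) := by ring
    _ ≤ 1136 * (n : ℝ) ^ 8 * (x * (2 * θ ^ 2) ^ 2) := by gcongr
    _ = 4544 * (n : ℝ) ^ 8 * (θ ^ 4 * x) := by ring
    _ ≤ 4544 * (n : ℝ) ^ 8 * 24 := by gcongr
    _ = _ := by ring

/-- In the range of the main theorem `n * p ≤ 1 / 2`, so a binomial sample of size `n` is empty with
probability at least `1 / 2`. -/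
theorem half_le_one_sub_pow {n m : ℕ} {p : ℝ} (hn : 0 < n) (hm : 12 * (n : ℝ) ^ 4 ≤ m)
    (hp0 : 0 ≤ p) (hp1 : p ≤ 1) (hp : p ≤ Real.sqrt (3 * Real.log n / m)) :
    1 / 2 ≤ (1 - p) ^ n := by
  have hn1 : (1 : ℝ) ≤ n := by exact_mod_cast hn
  have hm0 : (0 : ℝ) < m := lt_of_lt_of_le (by positivity) hm
  have hlog : Real.log n ≤ n := (Real.log_le_sub_one_of_pos (by linarith)).trans (by linarith)
  have hp2 : p ^ 2 ≤ 3 * Real.log n / m := by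
    rw [← Real.sq_sqrt (div_nonneg (mul_nonneg (by norm_num) (Real.log_nonneg hn1)) hm0.le)]
    exact pow_le_pow_left₀ hp0 hp 2
  rw [le_div_iff₀ hm0] at hp2
  -- The factor 12 in `hm` is chosen so that `log n ≤ n` yields exactly `1 / 4` here.
  have hnp : (n * p) ^ 2 ≤ (1 / 2) ^ 2 := by
    have h1 : p ^ 2 * (12 * (n : ℝ) ^ 4) ≤ 3 * n :=
      (mul_le_mul_of_nonneg_left hm (sq_nonneg p)).trans (hp2.trans (by linarith))
    have h2 : ((n * p) ^ 2 * n) * (12 * n) ≤ (1 / 4) * (12 * (n : ℝ)) := by nlinarith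
    have h3 : (n * p) ^ 2 * n ≤ (1 / 4 : ℝ) := le_of_mul_le_mul_right h2 (by positivity)
    have h4 : (n * p) ^ 2 * 1 ≤ (n * p) ^ 2 * n := mul_le_mul_of_nonneg_left hn1 (sq_nonneg _)
    linarith
  have hnp' : n * p ≤ 1 / 2 := (abs_le.1 (abs_le_of_sq_le_sq hnp (by norm_num))).2
  have := one_add_mul_le_pow (a := -p) (by linarith) n
  rw [← sub_eq_add_neg] at this
  linarith

theorem tvDist_randomCliqueGraph_cliqueProb_le {n m : ℕ} {p : I} (hn : 4 ≤ n)
    (hm : 12 * (n : ℝ) ^ 4 ≤ m) (hp : (p : ℝ) ≤ Real.sqrt (3 * Real.log n / m)) :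
    tvDist (randomCliqueGraph n (cliqueProb n m p 2) (cliqueProb n m p 3) (cliqueProb n m p 4))
      (SimpleGraph.binomialRandom (Fin n) (cliqueProb n m p 2)) ≤
      200 * Real.sqrt ((n : ℝ) ^ 4 / m) := by
  have hn0 : 0 < n := by omega
  have hn1 : (1 : ℝ) ≤ n := by exact_mod_cast hn0
  have hm0 : (0 : ℝ) < m := lt_of_lt_of_le (by positivity) hm
  have hmN : 0 < m := by exact_mod_cast hm0
  have hr := half_le_one_sub_pow hn0 hm p.2.1 p.2.2 hp
  have hr0 : 0 ≤ 1 - (p : ℝ) := sub_nonneg.2 p.2.2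
  set s := Real.sqrt ((n : ℝ) ^ 4 / m) with hs
  have hsq : (n : ℝ) ^ 4 / m = s ^ 2 := (Real.sq_sqrt (by positivity)).symm
  have hs0 : 0 ≤ s := Real.sqrt_nonneg _
  have hs1 : s ≤ 1 := by
    rw [hs, Real.sqrt_le_one, div_le_one hm0]
    nlinarith [pow_pos (zero_lt_one.trans_le hn1) 4]
  set t : ℕ → ℝ := fun k => (m : ℝ) * (p : ℝ) ^ k * (1 - (p : ℝ)) ^ (n - k) with ht
  have ht0 : ∀ k, 0 ≤ t k := fun k =>
    mul_nonneg (mul_nonneg m.cast_nonneg (pow_nonneg p.2.1 _)) (pow_nonneg hr0 _)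
  have hq : ∀ k, (cliqueProb n m p k : ℝ) = 1 - Real.exp (-t k) := fun k => rfl
  -- This makes the exponents `n - k` genuine; in both identities below the surplus power of `1 - p`
  -- is exactly `n`.
  obtain ⟨d, rfl⟩ : ∃ d, n = d + 4 := ⟨n - 4, by omega⟩
  have h3 : t 3 ^ 2 * m ≤ 2 * t 2 ^ 3 := by
    have e : t 2 ^ 3 = t 3 ^ 2 * m * (1 - (p : ℝ)) ^ (d + 4) := by
      simp only [ht, show d + 4 - 2 = d + 2 by omega, show d + 4 - 3 = d + 1 by omega]
      ring
    have := mul_le_mul_of_nonneg_left hr (mul_nonneg (sq_nonneg (t 3)) hm0.le)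
    linarith
  have h4 : t 4 * m ≤ 2 * t 2 ^ 2 := by
    have e : t 2 ^ 2 = t 4 * m * (1 - (p : ℝ)) ^ (d + 4) := by
      simp only [ht, show d + 4 - 2 = d + 2 by omega, show d + 4 - 4 = d by omega]
      ring
    have := mul_le_mul_of_nonneg_left hr (mul_nonneg (ht0 4) hm0.le)
    linarith
  set n := d + 4
  have hw : 0 < t 2 → ∀ j : ℕ, 0 ≤ ((cliqueProb n m p 2 : ℝ) ^ j.choose 2)⁻¹ - 1 := fun h2 j => by
    have : 0 < (cliqueProb n m p 2 : ℝ) := by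
      rw [hq]
      exact sub_pos.2 (Real.exp_lt_one_iff.2 (neg_lt_zero.2 h2))
    exact sub_nonneg.2 ((one_le_inv₀ (pow_pos this _)).2
      (pow_le_one₀ (cliqueProb n m p 2).2.1 (cliqueProb n m p 2).2.2))
  have hmoment : ∀ k, 0 < t 2 → ∀ f : SimpleGraph (Fin n) → ℝ, (∀ G, |f G| ≤ 1) →
      |∑ T ∈ (Finset.univ : Finset (Fin n)).powersetCard k,
        (∫ G, f (G ⊔ SimpleGraph.fromEdgeSet (cliqueEdges T : Set (Sym2 (Fin n))))
          ∂SimpleGraph.binomialRandom (Fin n) (cliqueProb n m p 2)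
          - ∫ G, f G ∂SimpleGraph.binomialRandom (Fin n) (cliqueProb n m p 2))| ≤
      Real.sqrt (∑ j ∈ Finset.range (k + 1), 2 ^ k * (n : ℝ) ^ (k + (k - j)) *
        (((1 - Real.exp (-t 2)) ^ j.choose 2)⁻¹ - 1)) := fun k h2 f hf => by
    have hpos : 0 < (cliqueProb n m p 2 : ℝ) := by
      rw [hq]
      exact sub_pos.2 (Real.exp_lt_one_iff.2 (neg_lt_zero.2 h2))
    exact Real.abs_le_sqrt ((sq_sum_plant_le n k _ hpos hf).trans (sum_card_inter_le n k (hw h2)))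
  have hsqrt : ∀ {B t c : ℝ}, 0 ≤ t → 0 ≤ c → B * t ^ 2 ≤ c ^ 2 → Real.sqrt B * t ≤ c :=
    fun {B t c} h0 hc h => by
      rw [← Real.sqrt_sq h0, ← Real.sqrt_mul' B (sq_nonneg t), Real.sqrt_le_left hc]
      exact h
  obtain ⟨D₃, hD₃, hD₃'⟩ : ∃ D₃ : ℝ, (∀ f : SimpleGraph (Fin n) → ℝ, (∀ G, |f G| ≤ 1) →
      |∑ T ∈ (Finset.univ : Finset (Fin n)).powersetCard 3,
        (∫ G, f (G ⊔ SimpleGraph.fromEdgeSet (cliqueEdges T : Set (Sym2 (Fin n))))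
          ∂SimpleGraph.binomialRandom (Fin n) (cliqueProb n m p 2)
          - ∫ G, f G ∂SimpleGraph.binomialRandom (Fin n) (cliqueProb n m p 2))| ≤ D₃) ∧
      D₃ * t 3 ≤ 23 * s := by
    -- If `t 2 = 0` then `p₂ = 0` and the second moment bound is unavailable, but `t 3 = 0` as well.
    rcases (ht0 2).eq_or_lt with h2 | h2
    · refine ⟨_, fun f hf => abs_sum_plant_le_card n 3 _ hf, ?_⟩
      have : t 3 = 0 := by
        rw [← h2] at h3
        have : t 3 ^ 2 ≤ 0 := by
          by_contra hcon
          have := mul_pos (not_le.1 hcon) hm0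
          linarith
        exact pow_eq_zero_iff (two_ne_zero) |>.1 (le_antisymm this (sq_nonneg _))
      rw [this]
      linarith
    · refine ⟨_, hmoment 3 h2, hsqrt (ht0 3) (by positivity) ?_⟩
      refine (triangle_second_moment_le hn0 hmN h2 h3).trans ?_
      rw [hsq]
      nlinarith [sq_nonneg s]
  obtain ⟨D₄, hD₄, hD₄'⟩ : ∃ D₄ : ℝ, (∀ f : SimpleGraph (Fin n) → ℝ, (∀ G, |f G| ≤ 1) →
      |∑ T ∈ (Finset.univ : Finset (Fin n)).powersetCard 4,
        (∫ G, f (G ⊔ SimpleGraph.fromEdgeSet (cliqueEdges T : Set (Sym2 (Fin n))))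
          ∂SimpleGraph.binomialRandom (Fin n) (cliqueProb n m p 2)
          - ∫ G, f G ∂SimpleGraph.binomialRandom (Fin n) (cliqueProb n m p 2))| ≤ D₄) ∧
      D₄ * t 4 ≤ 331 * s ^ 2 := by
    -- For `t 2 ≤ 1` the trivial bound `2 * n ^ 4` suffices, because `t 4 ≤ 2 / m`.
    rcases le_total (t 2) 1 with h2 | h2
    · refine ⟨_, fun f hf => abs_sum_plant_le_card n 4 _ hf, ?_⟩
      have h5 : t 4 * m ≤ 2 := h4.trans (by nlinarith [pow_le_one₀ (ht0 2) h2 (n := 2)])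
      rw [← le_div_iff₀ hm0] at h5
      calc _ ≤ 2 * (n : ℝ) ^ 4 * (2 / m) := by gcongr
        _ = 4 * ((n : ℝ) ^ 4 / m) := by ring
        _ ≤ _ := by rw [hsq]; nlinarith [sq_nonneg s]
    · refine ⟨_, hmoment 4 (by linarith), hsqrt (ht0 4) (by positivity) ?_⟩
      refine (four_clique_second_moment_le hn0 hmN h2 (ht0 4) h4).trans ?_
      rw [hsq]
      nlinarith [sq_nonneg (s ^ 2)]
  refine (tvDist_randomCliqueGraph_le (ht0 3) (ht0 4) (hq 3) (hq 4) hD₃ hD₄).trans ?_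
  have : s ^ 2 ≤ s := by nlinarith
  linarith

/-- With `w = m / n ^ 4`, this is `log w ≤ 2 * sqrt w`; only the second entry of the maximum is
needed. -/
theorem sqrt_div_le_errorTerm {n m : ℕ} (hn : 0 < n) (hm : (n : ℝ) ^ 4 < m) :
    Real.sqrt ((n : ℝ) ^ 4 / m) ≤ 2 * errorTerm n m := by
  have hn4 : (0 : ℝ) < (n : ℝ) ^ 4 := by positivity
  set w := (m : ℝ) / (n : ℝ) ^ 4 with hw
  have hw1 : 1 < w := (one_lt_div hn4).2 hm
  have hinv : (n : ℝ) ^ 4 / m = w⁻¹ := (inv_div _ _).symm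
  have hsw : 0 < Real.sqrt w := Real.sqrt_pos.2 (by linarith)
  have hlog : Real.log w ≤ 2 * Real.sqrt w := by
    have h1 := Real.log_le_sub_one_of_pos hsw
    rw [Real.log_sqrt (by linarith)] at h1
    linarith
  have h2 : 1 / Real.log w ≤ errorTerm n m := le_max_right _ _
  rw [hinv, Real.sqrt_inv]
  calc (Real.sqrt w)⁻¹ ≤ 2 * (1 / Real.log w) := by
        rw [inv_le_iff_one_le_mul₀ hsw, mul_one_div, div_mul_eq_mul_div,
          one_le_div (Real.log_pos hw1)]
        exact hlog
    _ ≤ _ := by gcongr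

end Estimates

end RandomCliqueUnion

end

theorem mainTheorem2 :
    ∃ C : ℝ, 0 < C ∧
      ∀ m : ℕ → ℕ, Tendsto (fun n : ℕ => (m n : ℝ) / (n : ℝ) ^ 4) atTop atTop →
        ∀ᶠ n : ℕ in atTop, ∀ p : I, (p : ℝ) ≤ Real.sqrt (3 * Real.log n / (m n : ℝ)) →
          RandomCliqueUnion.tvDist
              (RandomCliqueUnion.randomCliqueGraph n
                (RandomCliqueUnion.cliqueProb n (m n) p 2)
                (RandomCliqueUnion.cliqueProb n (m n) p 3)
                (RandomCliqueUnion.cliqueProb n (m n) p 4))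
              (SimpleGraph.binomialRandom (Fin n) (RandomCliqueUnion.cliqueProb n (m n) p 2))
            ≤ C * RandomCliqueUnion.errorTerm n (m n) := by
  -- The constant is 200 from the distance bound times 2 from `sqrt_div_le_errorTerm`.
  refine ⟨400, by norm_num, fun m hm => ?_⟩
  filter_upwards [hm.eventually_ge_atTop 12, eventually_ge_atTop 4] with n hn12 hn p hp
  have hn4 : (0 : ℝ) < (n : ℝ) ^ 4 := by
    have : 0 < n := by omega
    positivity
  rw [le_div_iff₀ hn4] at hn12
  refine (RandomCliqueUnion.tvDist_randomCliqueGraph_cliqueProb_le hn hn12 hp).trans ?_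
  have := RandomCliqueUnion.sqrt_div_le_errorTerm (n := n) (m := m n) (by omega) (by linarith)
  linarith
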